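/- Let $\mathbb K\in\{\mathbb R,\mathbb C\}$, let $\mathfrak k$ be a finite-dimensional Lie algebra over $\mathbb K$, let $M$ be a smooth manifold (finite-dimensional over $\mathbb R$, Hausdorff, paracompact and connected), and let $k\in\{0,1,2,\dots\}\cup\{\infty\}$. Let $\pi:\mathbb L\to M$ be a bundle of Lie algebras with fiber $\mathfrak k$, that is, a smooth vector bundle with fiber $\mathfrak k$ whose transition functions (for some bundle atlas) take values in $\operatorname{Aut}(\mathfrak k)$, so that each fiber $\mathbb L_x$ carries a Lie bracket for which the bundle charts restrict to Lie algebra isomorphisms $\mathbb L_x\to\mathfrak k$. Let $\Gamma^k(\mathbb L)$ be the $\mathbb K$-Lie algebra of $C^k$-sections of $\pi$ with the pointwise bracket $[X,Y](x)=[X(x),Y(x)]$. A Lie algebra is called \emph{indecomposable} if it is not the direct sum of two proper ideals (ideals different from the whole Lie algebra). If $\mathfrak k$ is indecomposable and $\operatorname{Hom}(\mathfrak k/[\mathfrak k,\mathfrak k],\mathfrak z(\mathfrak k))=0$, i.e. the only Lie algebra morphism from $\mathfrak k/[\mathfrak k,\mathfrak k]$ to the center $\mathfrak z(\mathfrak k)$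 of $\mathfrak k$ is zero, then $\Gamma^k(\mathbb L)$ is indecomposable. -/

import Mathlib

open Bundle
open scoped Manifold ContDiff

namespace LieBundle

/-- A Lie algebra is indecomposable if it is not the direct sum of two proper ideals. Here an ideal
is proper if it is not the whole Lie algebra. -/
def IsIndecomposable (𝕜 𝔤 : Type*) [CommRing 𝕜] [LieRing 𝔤] [LieAlgebra 𝕜 𝔤] : Prop :=
  ¬ ∃ I J : LieIdeal 𝕜 𝔤, I ≠ ⊤ ∧ J ≠ ⊤ ∧ IsCompl I J

section Pointwise

variable {𝕜 : Type*} [CommRing 𝕜] {M : Type*} {L : M → Type*}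
  [∀ x, LieRing (L x)] [∀ x, LieAlgebra 𝕜 (L x)]

/-- The pointwise bracket `⁅X, Y⁆ x = ⁅X x, Y x⁆` on families of elements of the fibers. -/
instance familyLieRing : LieRing (∀ x, L x) where
  bracket X Y := fun x => ⁅X x, Y x⁆
  add_lie _ _ _ := funext fun _ => add_lie _ _ _
  lie_add _ _ _ := funext fun _ => lie_add _ _ _
  lie_self _ := funext fun _ => lie_self _
  leibniz_lie _ _ _ := funext fun _ => leibniz_lie _ _ _

instance familyLieAlgebra : LieAlgebra 𝕜 (∀ x, L x) where
  lie_smul _ _ _ := funext fun _ => lie_smul _ _ _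

end Pointwise

section Bundle

variable (𝕜 : Type*) [RCLike 𝕜]
  {E : Type*} [NormedAddCommGroup E] [NormedSpace ℝ E]
  {H : Type*} [TopologicalSpace H] (I : ModelWithCorners ℝ E H)
  {M : Type*} [TopologicalSpace M] [ChartedSpace H M]
  (𝔨 : Type*) [LieRing 𝔨] [LieAlgebra 𝕜 𝔨]
  (F : Type*) [NormedAddCommGroup F] [NormedSpace ℝ F] [NormedSpace 𝕜 F]
  (L : M → Type*) [∀ x, LieRing (L x)] [∀ x, LieAlgebra 𝕜 (L x)]
  [TopologicalSpace (TotalSpace F L)] [∀ x, TopologicalSpace (L x)] [FiberBundle F L]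

/-- A smooth bundle `L` over `M`, whose fibers `L x` are Lie algebras over `𝕜`, is a bundle of Lie
algebras with fiber `𝔨` if `M` is covered by the base sets of bundle charts (local trivializations
`e` that are diffeomorphisms) that map each fiber isomorphically, as a Lie algebra over `𝕜`, onto
`𝔨`. Equivalently, the transition functions between these charts take their values in `Aut 𝔨`, and
the bracket of each fiber is the one transported from `𝔨`. The model space `F` of the bundle
is a normed space; the isomorphism `ψ` identifies it with the vector space underlying `𝔨` and does
not depend on the base point. -/
structure IsLieAlgebraBundle : Prop where
  exists_chart : ∀ x₀ : M, ∃ (e : Trivialization F (π F L)) (ψ : F ≃ₗ[𝕜] 𝔨),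
    x₀ ∈ e.baseSet ∧
    ContMDiffOn (I.prod 𝓘(ℝ, F)) (I.prod 𝓘(ℝ, F)) ∞ e e.source ∧
    ContMDiffOn (I.prod 𝓘(ℝ, F)) (I.prod 𝓘(ℝ, F)) ∞ e.toOpenPartialHomeomorph.symm e.target ∧
    ∀ x ∈ e.baseSet, ∃ φ : L x ≃ₗ⁅𝕜⁆ 𝔨, ∀ v : L x, φ v = ψ (e ⟨x, v⟩).2

end Bundle

section Sections

variable {E : Type*} [NormedAddCommGroup E] [NormedSpace ℝ E]
  {H : Type*} [TopologicalSpace H] (I : ModelWithCorners ℝ E H)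
  {M : Type*} [TopologicalSpace M] [ChartedSpace H M]
  (F : Type*) [NormedAddCommGroup F] [NormedSpace ℝ F]
  {L : M → Type*} [TopologicalSpace (TotalSpace F L)] [∀ x, TopologicalSpace (L x)]
  [FiberBundle F L]

/-- `X` is a `C^k`-section: it is `C^k` as a map from `M` to the total space of the bundle. -/
def IsCSection (k : ℕ∞) (X : ∀ x, L x) : Prop :=
  ContMDiff I (I.prod 𝓘(ℝ, F)) k (fun x => (⟨x, X x⟩ : TotalSpace F L))

variable {I F}

theorem contMDiffAt_section_iff_of_chart {k : ℕ∞} {X : ∀ x, L x} {x₀ : M}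
    {e : Trivialization F (π F L)} (hx₀ : x₀ ∈ e.baseSet)
    (he : ContMDiffOn (I.prod 𝓘(ℝ, F)) (I.prod 𝓘(ℝ, F)) ∞ e e.source)
    (he' : ContMDiffOn (I.prod 𝓘(ℝ, F)) (I.prod 𝓘(ℝ, F)) ∞
      e.toOpenPartialHomeomorph.symm e.target) :
    ContMDiffAt I (I.prod 𝓘(ℝ, F)) k (fun x => (⟨x, X x⟩ : TotalSpace F L)) x₀ ↔
      ContMDiffAt I 𝓘(ℝ, F) k (fun x => (e ⟨x, X x⟩).2) x₀ := by
  have hk : (k : WithTop ℕ∞) ≤ ∞ := by exact_mod_cast le_top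
  have hbase : ∀ᶠ x in nhds x₀, x ∈ e.baseSet := e.open_baseSet.mem_nhds hx₀
  constructor
  · intro h
    have hs : (⟨x₀, X x₀⟩ : TotalSpace F L) ∈ e.source := by simpa [e.mem_source] using hx₀
    have h1 : ContMDiffAt (I.prod 𝓘(ℝ, F)) (I.prod 𝓘(ℝ, F)) k e ⟨x₀, X x₀⟩ :=
      (he.contMDiffAt (e.open_source.mem_nhds hs)).of_le hk
    have h2 : ContMDiffAt I (I.prod 𝓘(ℝ, F)) k (fun x => e ⟨x, X x⟩) x₀ :=
      ContMDiffAt.comp (g := e) (f := fun x => (⟨x, X x⟩ : TotalSpace F L)) x₀ h1 h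
    exact contMDiffAt_snd.comp x₀ h2
  · intro h
    have hg : ContMDiffAt I (I.prod 𝓘(ℝ, F)) k (fun x => (x, (e ⟨x, X x⟩).2)) x₀ :=
      contMDiffAt_id.prodMk h
    have ht : (x₀, (e ⟨x₀, X x₀⟩).2) ∈ e.target := by simpa [e.mem_target] using hx₀
    have h1 := (he'.contMDiffAt (e.open_target.mem_nhds ht)).of_le hk
    have h2 := ContMDiffAt.comp (g := e.toOpenPartialHomeomorph.symm)
      (f := fun x => (x, (e ⟨x, X x⟩).2)) x₀ h1 hg
    refine h2.congr_of_eventuallyEq ?_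
    filter_upwards [hbase] with x hx
    have hs : (⟨x, X x⟩ : TotalSpace F L) ∈ e.source := by simpa [e.mem_source] using hx
    have h3 : (x, (e ⟨x, X x⟩).2) = e ⟨x, X x⟩ := by
      refine Prod.ext ?_ rfl
      exact (e.coe_fst hs).symm
    simp only [Function.comp, h3]
    exact (e.left_inv hs).symm

end Sections

section SectionAlgebra

variable {𝕜 : Type*} [RCLike 𝕜]
  {E : Type*} [NormedAddCommGroup E] [NormedSpace ℝ E]
  {H : Type*} [TopologicalSpace H] {I : ModelWithCorners ℝ E H}
  {M : Type*} [TopologicalSpace M] [ChartedSpace H M]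
  {𝔨 : Type*} [LieRing 𝔨] [LieAlgebra 𝕜 𝔨]
  {F : Type*} [NormedAddCommGroup F] [NormedSpace ℝ F] [NormedSpace 𝕜 F]
  {L : M → Type*} [∀ x, LieRing (L x)] [∀ x, LieAlgebra 𝕜 (L x)]
  [TopologicalSpace (TotalSpace F L)] [∀ x, TopologicalSpace (L x)] [FiberBundle F L]

/-- A pointwise operation on the fibers that a Lie chart carries to a smooth operation on the model
space preserves `C^k`-sections. -/
theorem IsCSection.of_chart {k : ℕ∞} (h : IsLieAlgebraBundle 𝕜 I 𝔨 F L) {X Y Z : ∀ x, L x}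
    (hX : IsCSection I F k X) (hY : IsCSection I F k Y)
    (T : (F ≃ₗ[𝕜] 𝔨) → F × F → F) (hT : ∀ ψ, ContDiff ℝ k (T ψ))
    (hZ : ∀ (ψ : F ≃ₗ[𝕜] 𝔨) (x : M) (φ : L x ≃ₗ⁅𝕜⁆ 𝔨),
      ψ (T ψ (ψ.symm (φ (X x)), ψ.symm (φ (Y x)))) = φ (Z x)) :
    IsCSection I F k Z := by
  intro x₀
  obtain ⟨e, ψ, hx₀, he, he', hφ⟩ := h.exists_chart x₀
  rw [contMDiffAt_section_iff_of_chart hx₀ he he']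
  have h1 := (contMDiffAt_section_iff_of_chart hx₀ he he').1 (hX x₀)
  have h2 := (contMDiffAt_section_iff_of_chart hx₀ he he').1 (hY x₀)
  have h3 : ContMDiffAt I 𝓘(ℝ, F) k
      (fun x => T ψ ((e ⟨x, X x⟩).2, (e ⟨x, Y x⟩).2)) x₀ :=
    ContMDiffAt.comp (g := T ψ) (f := fun x => ((e ⟨x, X x⟩).2, (e ⟨x, Y x⟩).2)) x₀
      (hT ψ).contDiffAt.contMDiffAt (h1.prodMk_space h2)
  refine h3.congr_of_eventuallyEq ?_
  filter_upwards [e.open_baseSet.mem_nhds hx₀] with x hx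
  obtain ⟨φ, hφ⟩ := hφ x hx
  apply ψ.injective
  rw [← hφ, ← hZ ψ x φ, hφ, hφ, ψ.symm_apply_apply, ψ.symm_apply_apply]

theorem contDiff_transportedBracket [IsScalarTower ℝ 𝕜 F] [FiniteDimensional 𝕜 𝔨] {k : ℕ∞}
    (ψ : F ≃ₗ[𝕜] 𝔨) : ContDiff ℝ k (fun p : F × F => ψ.symm ⁅ψ p.1, ψ p.2⁆) := by
  have : FiniteDimensional 𝕜 F := ψ.symm.finiteDimensional
  let B : F →ₗ[𝕜] F →ₗ[𝕜] F := LinearMap.mk₂ 𝕜 (fun a b => ψ.symm ⁅ψ a, ψ b⁆)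
    (by simp) (by simp) (by simp) (by simp)
  let B' : F →L[𝕜] F →L[𝕜] F :=
    LinearMap.toContinuousLinearMap (LinearMap.toContinuousLinearMap.toLinearMap ∘ₗ B)
  have hB : ContDiff 𝕜 k (fun p : F × F => B' p.1 p.2) := B'.isBoundedBilinearMap.contDiff
  exact hB.restrict_scalars ℝ

/-- The Lie algebra over `𝕜` of `C^k`-sections of a bundle of Lie algebras, with the pointwise
operations. -/
def sectionLieAlgebra [IsScalarTower ℝ 𝕜 F] [FiniteDimensional 𝕜 𝔨]
    (h : IsLieAlgebraBundle 𝕜 I 𝔨 F L) (k : ℕ∞) : LieSubalgebra 𝕜 (∀ x, L x) where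
  carrier := {X | IsCSection I F k X}
  zero_mem' := by
    intro x₀
    obtain ⟨e, ψ, hx₀, he, he', hφ⟩ := h.exists_chart x₀
    rw [contMDiffAt_section_iff_of_chart hx₀ he he']
    refine (contMDiffAt_const (c := (0 : F))).congr_of_eventuallyEq ?_
    filter_upwards [e.open_baseSet.mem_nhds hx₀] with x hx
    obtain ⟨φ, hφ⟩ := hφ x hx
    apply ψ.injective
    rw [← hφ]
    simp
  add_mem' {X Y} hX hY := IsCSection.of_chart h hX hY (fun _ p => p.1 + p.2)
    (fun _ => contDiff_fst.add contDiff_snd) (fun ψ x φ => by simp)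
  smul_mem' c X hX := IsCSection.of_chart h hX hX (fun _ p => c • p.1)
    (fun _ => ((((c • ContinuousLinearMap.id 𝕜 F).contDiff (n := k)).restrict_scalars ℝ).comp
      contDiff_fst)) (fun ψ x φ => by simp)
  lie_mem' {X Y} hX hY := IsCSection.of_chart h hX hY (fun ψ p => ψ.symm ⁅ψ p.1, ψ p.2⁆)
    contDiff_transportedBracket
    (fun ψ x φ => by
      change ψ (ψ.symm ⁅ψ (ψ.symm (φ (X x))), ψ (ψ.symm (φ (Y x)))⁆) = φ ⁅X x, Y x⁆
      simp only [LinearEquiv.apply_symm_apply, LieEquiv.map_lie])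

end SectionAlgebra

end LieBundle

/-! A nonzero functional on the abelianization times a nonzero central vector is a morphism into the
center, so the hypothesis on `Hom` forces `𝔨` to be centerless or perfect. Let the section algebra
be `A ⊕ B`. Then `A` and `B` commute, and since every fiber vector is the value of a section, the
values of `A` and of `B` at `x` form ideals of `L x` that together span it. The crux is that these
ideals meet trivially, that is, `a x = b x` forces `a x = 0`.

If the center is zero (`apply_eq_zero_of_center_eq_bot`), the common value commutes with the values
of `A` and of `B`, hence is central. If `𝔨` is perfect (`apply_eq_zero_of_perfect`), write `a - b =
∑ ⁅u i, w i⁆` with `u i x = 0` and split `w i = p i + q i` along `A ⊕ B`. Then `a - ∑ ⁅u i, p i⁆ = b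
+ ∑ ⁅u i, q i⁆` lies in `A ⊓ B = ⊥`, so `a = ∑ ⁅u i, p i⁆` vanishes at `x`. This needs finitely many
global sections `w i` spanning every fiber even if `M` is not compact (`exists_spansAt`), and a
solution `u` vanishing where `a - b` does (`exists_eq_sum_lie`).

Indecomposability of `𝔨` now kills one of the two ideals at each point. The loci where `A`,
respectively `B`, does not vanish are open and, unless the fibers are zero, complementary;
connectedness makes one of them empty (`eq_top_or_eq_top_of_isCompl`). -/

namespace LieBundle

/-! ### Sigma-compactness of the base -/

section Topology

open Set Topology

/-- A connected paracompact weakly locally compact space is `σ`-compact. -/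
theorem sigmaCompactSpace_of_connected_of_paracompact (X : Type*) [TopologicalSpace X]
    [ConnectedSpace X] [ParacompactSpace X] [WeaklyLocallyCompactSpace X] :
    SigmaCompactSpace X := by
  choose Q hQ hQx using fun x : X => exists_compact_mem_nhds x
  obtain ⟨t, ht, hcov, hlf, hsub⟩ := precise_refinement (fun x => interior (Q x))
    (fun _ => isOpen_interior)
    (eq_univ_of_forall fun x => mem_iUnion.2 ⟨x, mem_interior_iff_mem_nhds.2 (hQx x)⟩)
  have htQ : ∀ i, t i ⊆ Q i := fun i => (hsub i).trans interior_subset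
  have hex : ∀ x, ∃ i, x ∈ t i := fun x => mem_iUnion.1 (hcov ▸ mem_univ x)
  obtain ⟨x₀⟩ := (inferInstance : Nonempty X)
  -- Grow from a point by adding every `Q i` whose `t i` meets the previous stage. Local finiteness
  -- keeps each stage compact, and the union is open and closed.
  let C : ℕ → Set X := fun n => Nat.rec {x₀} (fun _ S => ⋃ i ∈ {i | (t i ∩ S).Nonempty}, Q i) n
  have hsucc : ∀ n, C (n + 1) = ⋃ i ∈ {i | (t i ∩ C n).Nonempty}, Q i := fun _ => rfl
  have hC : ∀ n, IsCompact (C n) := by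
    intro n
    induction n with
    | zero => exact isCompact_singleton
    | succ n ih =>
      rw [hsucc]
      exact (hlf.finite_nonempty_inter_compact ih).isCompact_biUnion fun i _ => hQ i
  have hmem : ∀ {i n}, (t i ∩ C n).Nonempty → t i ⊆ C (n + 1) := fun {i n} h x hx => by
    rw [hsucc]
    exact mem_biUnion (show i ∈ {i | (t i ∩ C n).Nonempty} from h) (htQ i hx)
  have hopen : IsOpen (⋃ n, C n) := by
    refine isOpen_iff_mem_nhds.2 fun x hx => ?_
    obtain ⟨n, hn⟩ := mem_iUnion.1 hx
    obtain ⟨i, hi⟩ := hex x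
    exact Filter.mem_of_superset ((ht i).mem_nhds hi)
      ((hmem ⟨x, hi, hn⟩).trans (subset_iUnion C (n + 1)))
  have hclosed : IsClosed (⋃ n, C n) := by
    refine isClosed_of_closure_subset fun x hx => ?_
    obtain ⟨i, hi⟩ := hex x
    obtain ⟨y, hyi, hy⟩ := mem_closure_iff.1 hx (t i) (ht i) hi
    obtain ⟨n, hn⟩ := mem_iUnion.1 hy
    exact mem_iUnion.2 ⟨n + 1, hmem ⟨y, hyi, hn⟩ hi⟩
  have huniv : (⋃ n, C n) = univ :=
    IsClopen.eq_univ ⟨hclosed, hopen⟩ ⟨x₀, mem_iUnion.2 ⟨0, rfl⟩⟩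
  exact ⟨⟨C, hC, huniv⟩⟩

end Topology

/-! ### Smooth right inverses -/

section RightInverse

/-- A surjective linear map between finite-dimensional spaces has a right inverse that depends
smoothly on the map. -/
theorem exists_contDiffAt_rightInverse {V F : Type*} [NormedAddCommGroup V] [NormedSpace ℝ V]
    [NormedAddCommGroup F] [NormedSpace ℝ F] [FiniteDimensional ℝ F]
    {S₀ : V →L[ℝ] F} (hS₀ : Function.Surjective S₀) (n : WithTop ℕ∞) :
    ∃ R : (V →L[ℝ] F) → F →L[ℝ] V,
      ∀ᶠ S in nhds S₀, ContDiffAt ℝ n R S ∧ ∀ z, S (R S z) = z := by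
  have : CompleteSpace F := FiniteDimensional.complete ℝ F
  obtain ⟨g, hg⟩ := S₀.toLinearMap.exists_rightInverse_of_surjective (LinearMap.range_eq_top.2 hS₀)
  let R₀ : F →L[ℝ] V := LinearMap.toContinuousLinearMap g
  let T : (V →L[ℝ] F) → F →L[ℝ] F := fun S => S.comp R₀
  have hT₀ : T S₀ = (ContinuousLinearEquiv.refl ℝ F : F →L[ℝ] F) := by
    ext z
    exact LinearMap.congr_fun hg z
  have hT : ContDiff ℝ n T := contDiff_id.clm_comp contDiff_const
  -- For a fixed right inverse `R₀` of `S₀`, the endomorphism `S ∘ R₀` is the identity at `S₀`,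
  -- hence invertible nearby, and `R₀ ∘ (S ∘ R₀)⁻¹` is a right inverse of `S`.
  refine ⟨fun S => R₀.comp (T S).inverse, ?_⟩
  have h := (hT.continuous.tendsto S₀).eventually (p := fun A => A ∈
    Set.range ((↑) : (F ≃L[ℝ] F) → F →L[ℝ] F)) (by
      rw [hT₀]
      exact ContinuousLinearEquiv.nhds _)
  filter_upwards [h] with S hS
  obtain ⟨A, hA⟩ := hS
  refine ⟨ContDiffAt.clm_comp contDiffAt_const ?_, fun z => ?_⟩
  · refine ContDiffAt.comp S (g := ContinuousLinearMap.inverse) ?_ hT.contDiffAt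
    rw [← hA]
    exact contDiffAt_map_inverse _
  · change T S ((T S).inverse z) = z
    rw [← hA, ContinuousLinearMap.inverse_equiv]
    exact A.apply_symm_apply z

end RightInverse

/-! ### Sections in Lie charts -/

section Charts

variable {𝕜 : Type*} [RCLike 𝕜]
  {E : Type*} [NormedAddCommGroup E] [NormedSpace ℝ E]
  {M : Type*} [TopologicalSpace M] [ChartedSpace E M]
  {𝔨 : Type*} [LieRing 𝔨] [LieAlgebra 𝕜 𝔨]
  {F : Type*} [NormedAddCommGroup F] [NormedSpace ℝ F] [NormedSpace 𝕜 F]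
  {L : M → Type*} [∀ x, LieRing (L x)] [∀ x, LieAlgebra 𝕜 (L x)]
  [TopologicalSpace (TotalSpace F L)] [∀ x, TopologicalSpace (L x)]
  [FiberBundle F L]

theorem IsCSection.of_top {L : M → Type*} [TopologicalSpace (TotalSpace F L)]
    [∀ x, TopologicalSpace (L x)] [FiberBundle F L] {k : ℕ∞} {X : ∀ x, L x} (hX : IsCSection 𝓘(ℝ, E) F ⊤ X) :
    IsCSection 𝓘(ℝ, E) F k X :=
  ContMDiff.of_le hX (by exact_mod_cast le_top)

/-- A bundle chart that is a diffeomorphism and maps each fiber isomorphically, as a Lie algebra,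
onto `F` with the bracket transported along `ψ : F ≃ₗ[𝕜] 𝔨`. -/
structure IsLieChart (e : Trivialization F (π F L)) (ψ : F ≃ₗ[𝕜] 𝔨) : Prop where
  contMDiffOn : ContMDiffOn (𝓘(ℝ, E).prod 𝓘(ℝ, F)) (𝓘(ℝ, E).prod 𝓘(ℝ, F)) ∞ e e.source
  contMDiffOn_symm : ContMDiffOn (𝓘(ℝ, E).prod 𝓘(ℝ, F)) (𝓘(ℝ, E).prod 𝓘(ℝ, F)) ∞
    e.toOpenPartialHomeomorph.symm e.target
  fiber : ∀ x ∈ e.baseSet, ∃ φ : L x ≃ₗ⁅𝕜⁆ 𝔨, ∀ v : L x, φ v = ψ (e ⟨x, v⟩).2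

theorem IsLieAlgebraBundle.exists_isLieChart (hL : IsLieAlgebraBundle 𝕜 𝓘(ℝ, E) 𝔨 F L) (x₀ : M) :
    ∃ (e : Trivialization F (π F L)) (ψ : F ≃ₗ[𝕜] 𝔨), x₀ ∈ e.baseSet ∧ IsLieChart (E := E) e ψ :=
  let ⟨e, ψ, hx₀, he, he', hφ⟩ := hL.exists_chart x₀
  ⟨e, ψ, hx₀, he, he', hφ⟩

namespace IsLieChart

variable {e : Trivialization F (π F L)} {ψ : F ≃ₗ[𝕜] 𝔨} (h : IsLieChart (E := E) e ψ)
include h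

theorem contMDiffAt_iff {k : ℕ∞} {X : ∀ x, L x} {x : M} (hx : x ∈ e.baseSet) :
    ContMDiffAt 𝓘(ℝ, E) (𝓘(ℝ, E).prod 𝓘(ℝ, F)) k (fun x => (⟨x, X x⟩ : TotalSpace F L)) x ↔
      ContMDiffAt 𝓘(ℝ, E) 𝓘(ℝ, F) k (fun x => (e ⟨x, X x⟩).2) x :=
  contMDiffAt_section_iff_of_chart hx h.contMDiffOn h.contMDiffOn_symm

/-- The trivialization `e` is not assumed linear on fibers; its linearity comes from `ψ⁻¹ ∘ φ`.
Scalars are restricted to `ℝ` because cutoffs and derivatives are real. -/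
theorem exists_linearEquiv [IsScalarTower ℝ 𝕜 F]
    [∀ x, Module ℝ (L x)] [∀ x, IsScalarTower ℝ 𝕜 (L x)] {x : M} (hx : x ∈ e.baseSet) :
    ∃ ε : L x ≃ₗ[ℝ] F, (∀ v, (e ⟨x, v⟩).2 = ε v) ∧
      ∀ u v, ε ⁅u, v⁆ = ψ.symm ⁅ψ (ε u), ψ (ε v)⁆ := by
  obtain ⟨φ, hφ⟩ := h.fiber x hx
  refine ⟨(φ.toLinearEquiv.trans ψ.symm).restrictScalars ℝ, fun v => ?_, fun u v => ?_⟩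
  · apply ψ.injective
    rw [← hφ]
    exact (ψ.apply_symm_apply _).symm
  · change ψ.symm (φ ⁅u, v⁆) = ψ.symm ⁅ψ (ψ.symm (φ u)), ψ (ψ.symm (φ v))⁆
    simp only [LinearEquiv.apply_symm_apply]
    exact congrArg ψ.symm (φ.map_lie u v)

/-- The local section with principal part `g` in a chart. -/
theorem contMDiffAt_symm {k : ℕ∞} {g : M → F} {x : M} (hx : x ∈ e.baseSet)
    (hg : ContMDiffAt 𝓘(ℝ, E) 𝓘(ℝ, F) k g x) :
    ContMDiffAt 𝓘(ℝ, E) (𝓘(ℝ, E).prod 𝓘(ℝ, F)) k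
      (fun x => (⟨x, e.symm x (g x)⟩ : TotalSpace F L)) x := by
  rw [h.contMDiffAt_iff hx]
  refine hg.congr_of_eventuallyEq ?_
  filter_upwards [e.open_baseSet.mem_nhds hx] with y hy
  rw [e.apply_mk_symm hy]

end IsLieChart

/-- The set of points where a section does not vanish is open. -/
theorem IsCSection.isOpen_ne_zero [IsScalarTower ℝ 𝕜 F]
    [∀ x, Module ℝ (L x)] [∀ x, IsScalarTower ℝ 𝕜 (L x)] (hL : IsLieAlgebraBundle 𝕜 𝓘(ℝ, E) 𝔨 F L)
    {k : ℕ∞} {X : ∀ x, L x} (hX : IsCSection 𝓘(ℝ, E) F k X) : IsOpen {x | X x ≠ 0} := by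
  refine isOpen_iff_mem_nhds.2 fun x₀ hx₀X => ?_
  obtain ⟨e, ψ, hx₀, h⟩ := hL.exists_isLieChart x₀
  have hc := ((h.contMDiffAt_iff hx₀).1 (hX x₀)).continuousAt
  obtain ⟨ε, hε, -⟩ := h.exists_linearEquiv hx₀
  have h0 : (e ⟨x₀, X x₀⟩).2 ≠ 0 := by
    rw [hε]
    simpa using hx₀X
  filter_upwards [hc.eventually_ne h0, e.open_baseSet.mem_nhds hx₀] with x hx hxe
  obtain ⟨ε, hε, -⟩ := h.exists_linearEquiv hxe
  rw [hε] at hx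
  simpa using hx

end Charts

/-! ### Extending fiber vectors to global sections -/

section GlobalSections

variable {𝕜 : Type*} [RCLike 𝕜]
  {E : Type*} [NormedAddCommGroup E] [NormedSpace ℝ E] [FiniteDimensional ℝ E]
  {M : Type*} [TopologicalSpace M] [ChartedSpace E M] [IsManifold 𝓘(ℝ, E) ∞ M] [T2Space M]
  {𝔨 : Type*} [LieRing 𝔨] [LieAlgebra 𝕜 𝔨]
  {F : Type*} [NormedAddCommGroup F] [NormedSpace ℝ F] [NormedSpace 𝕜 F]
  {L : M → Type*} [∀ x, LieRing (L x)] [∀ x, LieAlgebra 𝕜 (L x)]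
  [∀ x, Module ℝ (L x)]
  [TopologicalSpace (TotalSpace F L)] [∀ x, TopologicalSpace (L x)]
  [FiberBundle F L] [VectorBundle ℝ F L]

/-- A vector of the model fiber extends to a smooth section that is constant in a given chart near
a given point. -/
theorem IsLieChart.exists_section {e : Trivialization F (π F L)} {ψ : F ≃ₗ[𝕜] 𝔨}
    (h : IsLieChart (E := E) e ψ) {x₀ : M} (hx₀ : x₀ ∈ e.baseSet) :
    ∃ s : F → ∀ x, L x, (∀ v, IsCSection 𝓘(ℝ, E) F ⊤ (s v)) ∧
      ∀ᶠ x in nhds x₀, ∀ v, (e ⟨x, s v x⟩).2 = v := by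
  obtain ⟨f, -, hf⟩ := (SmoothBumpFunction.nhds_basis_tsupport (I := 𝓘(ℝ, E)) x₀).mem_iff.1
    (e.open_baseSet.mem_nhds hx₀)
  refine ⟨fun v x => f x • e.symm x v, fun v => ?_, ?_⟩
  · refine ContMDiffOn.smul_section_of_tsupport (s := fun x => e.symm x v) (u := e.baseSet)
      f.contMDiff.contMDiffOn e.open_baseSet hf fun x hx => ?_
    exact (h.contMDiffAt_symm (k := ⊤) hx contMDiffAt_const).contMDiffWithinAt
  · filter_upwards [f.eventuallyEq_one, e.open_baseSet.mem_nhds hx₀] with x hx hxe v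
    rw [hx, Pi.one_apply, one_smul, e.apply_mk_symm hxe]

variable [IsScalarTower ℝ 𝕜 F] [∀ x, IsScalarTower ℝ 𝕜 (L x)]

/-- Every element of a fiber is the value of a smooth section. -/
theorem IsLieAlgebraBundle.exists_section_eq (hL : IsLieAlgebraBundle 𝕜 𝓘(ℝ, E) 𝔨 F L) (x₀ : M)
    (v : L x₀) : ∃ X : ∀ x, L x, IsCSection 𝓘(ℝ, E) F ⊤ X ∧ X x₀ = v := by
  obtain ⟨e, ψ, hx₀, h⟩ := hL.exists_isLieChart x₀
  obtain ⟨s, hs, hse⟩ := h.exists_section hx₀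
  obtain ⟨ε, hε, -⟩ := h.exists_linearEquiv hx₀
  refine ⟨s (ε v), hs _, ε.injective ?_⟩
  rw [← hε]
  exact hse.self_of_nhds _

end GlobalSections

/-! ### Finitely many sections spanning all fibers -/

section Spanning

open Module

variable {𝕜 : Type*} [RCLike 𝕜]
  {E : Type*} [NormedAddCommGroup E] [NormedSpace ℝ E] [FiniteDimensional ℝ E]
  {M : Type*} [TopologicalSpace M] [ChartedSpace E M]
  {𝔨 : Type*} [LieRing 𝔨] [LieAlgebra 𝕜 𝔨]
  {F : Type*} [NormedAddCommGroup F] [NormedSpace ℝ F] [NormedSpace 𝕜 F] [IsScalarTower ℝ 𝕜 F]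
  [FiniteDimensional ℝ F]
  {L : M → Type*} [∀ x, LieRing (L x)] [∀ x, LieAlgebra 𝕜 (L x)]
  [∀ x, Module ℝ (L x)] [∀ x, IsScalarTower ℝ 𝕜 (L x)]
  [TopologicalSpace (TotalSpace F L)] [∀ x, TopologicalSpace (L x)]
  [FiberBundle F L]

/-- The coefficient vectors `(λ (w i x))ᵢ` of linear forms `λ` on the fibers over `K`. -/
def formValues {ι : Type*} (w : ι → ∀ x, L x) (K : Set M) : Set (ι → ℝ) :=
  {α | ∃ x ∈ K, ∃ l : L x →ₗ[ℝ] ℝ, ∀ i, α i = l (w i x)}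

/-- In a chart, a form on a fiber is a point of `E × F*` and its coefficients depend on that point
in a `C¹` way; a `C¹` map does not raise Hausdorff dimension above that of its domain. -/
theorem IsLieAlgebraBundle.exists_dimH_formValues_le (hL : IsLieAlgebraBundle 𝕜 𝓘(ℝ, E) 𝔨 F L)
    {ι : Type*} [Fintype ι] {w : ι → ∀ x, L x} (hw : ∀ i, IsCSection 𝓘(ℝ, E) F ⊤ (w i)) (x₀ : M) :
    ∃ U ∈ nhds x₀, dimH (formValues w U) ≤ (finrank ℝ E + finrank ℝ F : ℕ) := by
  obtain ⟨e, ψ, hx₀, h⟩ := hL.exists_isLieChart x₀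
  let c := extChartAt 𝓘(ℝ, E) x₀
  let g : ι → E → F := fun i y => (e ⟨c.symm y, w i (c.symm y)⟩).2
  have hg : ∀ i, ContDiffAt ℝ 1 (g i) (c x₀) := fun i => by
    have h1 := ((h.contMDiffAt_iff hx₀).1 (hw i x₀)).of_le (m := 1) (by exact_mod_cast le_top)
    have h2 := (contMDiffAt_iff.1 h1).2
    rw [modelWithCornersSelf_coe, Set.range_id] at h2
    simpa using! h2
  have hg' : ∀ᶠ y in nhds (c x₀), ∀ i, ContDiffAt ℝ 1 (g i) y :=
    Filter.eventually_all.2 fun i => (hg i).eventually (by simp)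
  obtain ⟨r, hr, hball⟩ := Metric.eventually_nhds_iff_ball.1 hg'
  let G : E × (F →L[ℝ] ℝ) → ι → ℝ := fun p i => p.2 (g i p.1)
  have hG : ContDiffOn ℝ 1 G (Metric.ball (c x₀) r ×ˢ Set.univ) := by
    refine contDiffOn_pi.2 fun i p hp => ContDiffAt.contDiffWithinAt ?_
    exact contDiffAt_snd.clm_apply ((hball p.1 hp.1 i).comp p contDiffAt_fst)
  have hdim : dimH (G '' (Metric.ball (c x₀) r ×ˢ Set.univ)) ≤
      (finrank ℝ E + finrank ℝ F : ℕ) := by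
    refine (hG.dimH_image_le ((convex_ball _ _).prod convex_univ) subset_rfl).trans ?_
    refine (dimH_mono (Set.subset_univ _)).trans ?_
    rw [Real.dimH_univ_eq_finrank, finrank_prod,
      ← (LinearMap.toContinuousLinearMap (𝕜 := ℝ) (E := F) (F' := ℝ)).finrank_eq,
      finrank_linearMap, finrank_self, mul_one]
  refine ⟨c.source ∩ c ⁻¹' Metric.ball (c x₀) r ∩ e.baseSet, ?_, (dimH_mono ?_).trans hdim⟩
  · refine Filter.inter_mem (Filter.inter_mem (extChartAt_source_mem_nhds x₀) ?_)
      (e.open_baseSet.mem_nhds hx₀)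
    exact (continuousAt_extChartAt x₀).preimage_mem_nhds (Metric.ball_mem_nhds _ hr)
  · rintro α ⟨x, ⟨⟨hxc, hxr⟩, hxe⟩, l, hl⟩
    obtain ⟨ε, hε, -⟩ := h.exists_linearEquiv hxe
    refine ⟨(c x, LinearMap.toContinuousLinearMap (l ∘ₗ ε.symm.toLinearMap)),
      ⟨hxr, Set.mem_univ _⟩, funext fun i => ?_⟩
    have hcx : c.symm (c x) = x := c.left_inv hxc
    have hgx : g i (c x) = ε (w i x) := by
      rw [← hε]
      change (e ⟨c.symm (c x), w i (c.symm (c x))⟩).2 = _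
      rw [hcx]
    change l (ε.symm (g i (c x))) = α i
    rw [hgx, ε.symm_apply_apply, hl]

theorem IsLieAlgebraBundle.dimH_formValues_le (hL : IsLieAlgebraBundle 𝕜 𝓘(ℝ, E) 𝔨 F L)
    {ι : Type*} [Fintype ι] {w : ι → ∀ x, L x} (hw : ∀ i, IsCSection 𝓘(ℝ, E) F ⊤ (w i))
    {K : Set M} (hK : IsCompact K) :
    dimH (formValues w K) ≤ (finrank ℝ E + finrank ℝ F : ℕ) := by
  refine hK.induction_on (p := fun S => dimH (formValues w S) ≤ (finrank ℝ E + finrank ℝ F : ℕ))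
    ?_ ?_ ?_ ?_
  · have : formValues w (∅ : Set M) = ∅ := by
      ext α
      simp [formValues]
    rw [this, dimH_empty]
    exact zero_le
  · intro S T hST hT
    have : formValues w S ⊆ formValues w T := fun α ⟨x, hx, hl⟩ => ⟨x, hST hx, hl⟩
    exact (dimH_mono this).trans hT
  · intro S T hS hT
    have : formValues w (S ∪ T) ⊆ formValues w S ∪ formValues w T := by
      rintro α ⟨x, hx | hx, hl⟩
      exacts [Or.inl ⟨x, hx, hl⟩, Or.inr ⟨x, hx, hl⟩]
    refine (dimH_mono this).trans ?_
    rw [dimH_union]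
    exact max_le hS hT
  · intro x _
    obtain ⟨U, hU, hdim⟩ := hL.exists_dimH_formValues_le hw x
    exact ⟨U, nhdsWithin_le_nhds hU, hdim⟩

/-- No nonzero linear form on the fiber at `x` kills all the values `w i x`. -/
def SpansAt {ι : Type*} (w : ι → ∀ x, L x) (x : M) : Prop :=
  ∀ l : L x →ₗ[ℝ] ℝ, (∀ i, l (w i x) = 0) → l = 0

variable [VectorBundle ℝ F L]

/-- A generic projection, as in Whitney's embedding theorem. By dimension some `α` is not the
coefficient vector of any form over `K`, and one section can be eliminated along `α`: a form killing
all the new sections has coefficients proportional to `α`, hence zero. -/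
theorem IsLieAlgebraBundle.exists_spansAt_of_lt (hL : IsLieAlgebraBundle 𝕜 𝓘(ℝ, E) 𝔨 F L)
    {n : ℕ} {w : Fin (n + 1) → ∀ x, L x} (hw : ∀ i, IsCSection 𝓘(ℝ, E) F ⊤ (w i))
    {K : Set M} (hK : IsCompact K) (hwK : ∀ x ∈ K, SpansAt w x)
    (hn : finrank ℝ E + finrank ℝ F ≤ n) :
    ∃ w' : Fin n → ∀ x, L x, (∀ i, IsCSection 𝓘(ℝ, E) F ⊤ (w' i)) ∧ ∀ x ∈ K, SpansAt w' x := by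
  -- Adjoining `0` guarantees `α ≠ 0` even for empty `K`, where `formValues w K` is empty.
  have hdim : dimH (formValues w K ∪ {0}) < finrank ℝ (Fin (n + 1) → ℝ) := by
    rw [dimH_union, dimH_singleton, max_eq_left zero_le, finrank_fin_fun]
    exact (hL.dimH_formValues_le hw hK).trans_lt (by exact_mod_cast Nat.lt_succ_of_le hn)
  obtain ⟨α, hα⟩ := (dense_compl_of_dimH_lt_finrank hdim).nonempty
  have hα0 : α ≠ 0 := fun h0 => hα (Or.inr h0)
  obtain ⟨i₀, hi₀⟩ := Function.ne_iff.1 hα0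
  refine ⟨fun j => w (i₀.succAbove j) + (-(α (i₀.succAbove j) / α i₀)) • w i₀, fun j => ?_, ?_⟩
  · exact (hw _).add_section (ContMDiff.const_smul_section (hw _))
  · intro x hx l hl
    have hprop : ∀ i, l (w i x) = l (w i₀ x) / α i₀ * α i := by
      intro i
      rcases Fin.eq_self_or_eq_succAbove i₀ i with rfl | ⟨j, rfl⟩
      · rw [div_mul_cancel₀ _ hi₀]
      · have := hl j
        simp only [Pi.add_apply, Pi.smul_apply, map_add, map_smul, smul_eq_mul] at this
        rw [eq_neg_of_add_eq_zero_left this]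
        ring
    by_cases ht : l (w i₀ x) = 0
    · exact hwK x hx l fun i => by rw [hprop, ht, zero_div, zero_mul]
    -- Forms can be rescaled, so a nonzero multiple of `α` among the coefficient vectors would put
    -- `α` itself there.
    · refine absurd (Or.inl ⟨x, hx, (α i₀ / l (w i₀ x)) • l, fun i => ?_⟩) hα
      rw [LinearMap.smul_apply, hprop i, smul_eq_mul]
      have : α i₀ ≠ 0 := hi₀
      field_simp

variable [IsManifold 𝓘(ℝ, E) ∞ M] [T2Space M]

theorem IsLieAlgebraBundle.exists_finite_spansAt (hL : IsLieAlgebraBundle 𝕜 𝓘(ℝ, E) 𝔨 F L)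
    {K : Set M} (hK : IsCompact K) :
    ∃ (n : ℕ) (w : Fin n → ∀ x, L x), (∀ i, IsCSection 𝓘(ℝ, E) F ⊤ (w i)) ∧
      ∀ x ∈ K, SpansAt w x := by
  refine hK.induction_on (p := fun S => ∃ (n : ℕ) (w : Fin n → ∀ x, L x),
    (∀ i, IsCSection 𝓘(ℝ, E) F ⊤ (w i)) ∧ ∀ x ∈ S, SpansAt w x) ?_ ?_ ?_ ?_
  · exact ⟨0, Fin.elim0, fun i => i.elim0, fun x hx => hx.elim⟩
  · rintro S T hST ⟨n, w, hw, hwT⟩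
    exact ⟨n, w, hw, fun x hx => hwT x (hST hx)⟩
  · rintro S T ⟨n, w, hw, hwS⟩ ⟨m, v, hv, hvT⟩
    refine ⟨n + m, Fin.append w v, fun i => ?_, ?_⟩
    · induction i using Fin.addCases with
      | left i => rw [Fin.append_left]; exact hw i
      | right i => rw [Fin.append_right]; exact hv i
    · rintro x (hx | hx) l hl
      · exact hwS x hx l fun i => by simpa using hl (Fin.castAdd m i)
      · exact hvT x hx l fun i => by simpa using hl (Fin.natAdd n i)
  · intro x₀ _
    obtain ⟨e, ψ, hx₀, h⟩ := hL.exists_isLieChart x₀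
    obtain ⟨s, hs, hse⟩ := h.exists_section hx₀
    let b := finBasis ℝ F
    refine ⟨_, nhdsWithin_le_nhds (Filter.inter_mem hse (e.open_baseSet.mem_nhds hx₀)),
      _, fun i => s (b i), fun i => hs _, ?_⟩
    rintro x ⟨hx, hxe⟩ l hl
    obtain ⟨ε, hε, -⟩ := h.exists_linearEquiv hxe
    have : l ∘ₗ ε.symm.toLinearMap = 0 := b.ext fun i => by
      have hb : ε (s (b i) x) = b i := by rw [← hε]; exact hx _
      change l (ε.symm (b i)) = 0
      rw [← hb, ε.symm_apply_apply, hl]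
    ext v
    simpa using! LinearMap.congr_fun this (ε v)

/-- The number of sections does not depend on `K`, so families chosen on different compact sets can
be added index by index. -/
theorem IsLieAlgebraBundle.exists_spansAt_of_isCompact
    (hL : IsLieAlgebraBundle 𝕜 𝓘(ℝ, E) 𝔨 F L) {K : Set M} (hK : IsCompact K) :
    ∃ w : Fin (finrank ℝ E + finrank ℝ F) → ∀ x, L x,
      (∀ i, IsCSection 𝓘(ℝ, E) F ⊤ (w i)) ∧ ∀ x ∈ K, SpansAt w x := by
  obtain ⟨n, w, hw, hwK⟩ := hL.exists_finite_spansAt hK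
  have key : ∀ m : ℕ, ∃ w : Fin (finrank ℝ E + finrank ℝ F + (n - m)) → ∀ x, L x,
      (∀ i, IsCSection 𝓘(ℝ, E) F ⊤ (w i)) ∧ ∀ x ∈ K, SpansAt w x := by
    intro m
    induction m with
    | zero =>
      -- Padding with zero sections makes the count at least `finrank ℝ E + finrank ℝ F` whatever
      -- `n` is.
      refine ⟨Fin.append (fun _ => 0) w, fun i => ?_, fun x hx l hl => hwK x hx l fun i => ?_⟩
      · induction i using Fin.addCases with
        | left i =>
          rw [Fin.append_left]
          exact (contMDiff_zeroSection ℝ L).of_le le_top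
        | right i => rw [Fin.append_right]; exact hw i
      · simpa using! hl (Fin.natAdd _ i)
    | succ m ih =>
      rcases Nat.lt_or_ge m n with hmn | hmn
      · obtain ⟨q, hq⟩ : ∃ q, n - m = q + 1 := ⟨n - m - 1, by omega⟩
        have hq' : n - (m + 1) = q := by omega
        rw [hq']
        rw [hq] at ih
        obtain ⟨w, hw, hwK⟩ := ih
        exact hL.exists_spansAt_of_lt (n := _ + q) hw hK hwK (Nat.le_add_right _ _)
      · have : n - (m + 1) = n - m := by omega
        rwa [this]
  have := key n
  rwa [Nat.sub_self] at this

/-- The fibers of a bundle of Lie algebras over a `σ`-compact manifold are spanned by finitely many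
global smooth sections. -/
theorem IsLieAlgebraBundle.exists_spansAt [SigmaCompactSpace M]
    (hL : IsLieAlgebraBundle 𝕜 𝓘(ℝ, E) 𝔨 F L) :
    ∃ w : Fin 3 × Fin (finrank ℝ E + finrank ℝ F) → ∀ x, L x,
      (∀ i, IsCSection 𝓘(ℝ, E) F ⊤ (w i)) ∧ ∀ x, SpansAt w x := by
  have : LocallyCompactSpace M := Manifold.locallyCompact_of_finiteDimensional 𝓘(ℝ, E)
  let K := (CompactExhaustion.choice M).shiftr
  let A : ℕ → Set M := fun n => K (n + 1) \ interior (K n)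
  -- Shells `U n` with indices in one residue class mod 3 are pairwise disjoint, so three colors
  -- suffice. For `n = 0` the truncated `n - 1` is harmless: the shifted exhaustion has `K 0 = ∅`.
  let U : ℕ → Set M := fun n => interior (K (n + 2)) \ K (n - 1)
  have hA : ∀ n, IsCompact (A n) := fun n => (K.isCompact _).diff isOpen_interior
  have hU : ∀ n, IsOpen (U n) := fun n => isOpen_interior.sdiff (K.isCompact _).isClosed
  have hAU : ∀ n, A n ⊆ U n := fun n x hx => by
    refine ⟨K.subset_interior_succ _ hx.1, fun hxK => ?_⟩
    rcases n with _ | n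
    · exact hxK
    · exact hx.2 (K.subset_interior_succ _ hxK)
  have hAcov : ∀ x, ∃ n, x ∈ A n := fun x =>
    ⟨(CompactExhaustion.choice M).find x, by
      have h := (CompactExhaustion.choice M).mem_sdiff_shiftr_find x
      exact ⟨h.1, fun h' => h.2 (interior_subset h')⟩⟩
  have hlf : LocallyFinite U := fun x => by
    obtain ⟨m, hm⟩ := K.exists_mem_nhds x
    refine ⟨K m, hm, (Set.finite_le_nat m).subset ?_⟩
    rintro n ⟨y, hy, hym⟩
    by_contra hnm
    exact hy.2 (K.subset (by rw [Set.mem_ofPred_eq] at hnm; omega) hym)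
  have hdisj : ∀ {n m x}, x ∈ U n → x ∈ U m → n % 3 = m % 3 → n ≤ m := by
    intro n m x hn hm hnm
    by_contra hlt
    exact hn.2 (K.subset (by omega) (interior_subset hm.1))
  choose χ hχ _ hχU hχA using fun n =>
    exists_contMDiff_support_eq_eq_one_iff (n := ⊤) 𝓘(ℝ, E) (hU n) (hA n).isClosed (hAU n)
  choose w hw hwA using fun n => hL.exists_spansAt_of_isCompact (hA n)
  let t : Fin 3 × Fin (finrank ℝ E + finrank ℝ F) → ℕ → ∀ x, L x := fun p n =>
    if n % 3 = p.1 then χ n • w n p.2 else 0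
  have ht0 : ∀ {p n x}, x ∉ U n → t p n x = 0 := by
    intro p n x hx
    have : χ n x = 0 := by rwa [← Function.notMem_support, hχU]
    by_cases hn : n % 3 = p.1 <;> simp [t, hn, this]
  refine ⟨fun p x => ∑ᶠ n, t p n x, fun p => ?_, fun x l hl => ?_⟩
  · refine ContMDiff.finsum_section_of_locallyFinite (hlf.subset fun n x hx => ?_) fun n => ?_
    · by_contra hxU
      exact hx (ht0 hxU)
    · by_cases hn : n % 3 = p.1
      · simp only [t, if_pos hn]
        exact (hχ n).smul_section (hw n p.2)
      · simp only [t, if_neg hn]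
        exact (contMDiff_zeroSection ℝ L).of_le le_top
  · obtain ⟨n, hn⟩ := hAcov x
    refine hwA n x hn l fun i => ?_
    rw [← hl (⟨n % 3, Nat.mod_lt _ (by norm_num)⟩, i)]
    refine congrArg l (Eq.symm ?_)
    change ∑ᶠ m, t (⟨n % 3, _⟩, i) m x = w n i x
    rw [finsum_eq_single _ n]
    · simp [t, (hχA n x).1 hn]
    · intro m hmn
      by_cases hm : m % 3 = n % 3
      · refine ht0 fun hxm => hmn (le_antisymm ?_ ?_)
        exacts [hdisj hxm (hAU n hn) hm, hdisj (hAU n hn) hxm hm.symm]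
      · simp [t, hm]

end Spanning
-- The bracket on the model fiber
section TransportedBracket

variable {𝕜 : Type*} [RCLike 𝕜] {𝔨 : Type*} [LieRing 𝔨] [LieAlgebra 𝕜 𝔨]
  {F : Type*} [NormedAddCommGroup F] [NormedSpace ℝ F] [NormedSpace 𝕜 F] [IsScalarTower ℝ 𝕜 F]
  [FiniteDimensional ℝ F]

/-- The bracket of `𝔨` transported to `F`, as a continuous real bilinear map. -/
noncomputable def transportedBracket (ψ : F ≃ₗ[𝕜] 𝔨) : F →L[ℝ] F →L[ℝ] F :=
  LinearMap.toContinuousLinearMap (LinearMap.toContinuousLinearMap.toLinearMap ∘ₗ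
    LinearMap.mk₂ ℝ (fun a b => ψ.symm ⁅ψ a, ψ b⁆) (by simp)
      (fun c a b => by
        rw [← algebraMap_smul 𝕜 c a, map_smul, smul_lie, map_smul, algebraMap_smul])
      (by simp)
      (fun c a b => by
        rw [← algebraMap_smul 𝕜 c b, map_smul, lie_smul, map_smul, algebraMap_smul]))

theorem transportedBracket_apply (ψ : F ≃ₗ[𝕜] 𝔨) (a b : F) :
    transportedBracket ψ a b = ψ.symm ⁅ψ a, ψ b⁆ := rfl

/-- The map `u ↦ ∑ i, ⁅u i, w i⁆` for the transported bracket. -/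
noncomputable def sumBracket {ι : Type*} [Fintype ι] (ψ : F ≃ₗ[𝕜] 𝔨) (w : ι → F) :
    (ι → F) →L[ℝ] F :=
  ∑ i, ((transportedBracket ψ).flip (w i)).comp (ContinuousLinearMap.proj i)

theorem sumBracket_apply {ι : Type*} [Fintype ι] (ψ : F ≃ₗ[𝕜] 𝔨) (w u : ι → F) :
    sumBracket ψ w u = ∑ i, ψ.symm ⁅ψ (u i), ψ (w i)⁆ := by
  simp [sumBracket, transportedBracket_apply]

theorem contDiff_sumBracket {ι : Type*} [Fintype ι] (ψ : F ≃ₗ[𝕜] 𝔨) (n : WithTop ℕ∞) :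
    ContDiff ℝ n (sumBracket ψ : (ι → F) → (ι → F) →L[ℝ] F) := by
  refine ContDiff.sum fun i _ => ContDiff.clm_comp ?_ contDiff_const
  exact (transportedBracket ψ).flip.contDiff.comp (contDiff_apply ℝ F i)

theorem surjective_sumBracket (h : ⁅(⊤ : LieIdeal 𝕜 𝔨), (⊤ : LieIdeal 𝕜 𝔨)⁆ = ⊤)
    {ι : Type*} [Fintype ι] (ψ : F ≃ₗ[𝕜] 𝔨) {w : ι → F}
    (hw : Submodule.span ℝ (Set.range w) = ⊤) : Function.Surjective (sumBracket ψ w) := by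
  classical
  let R : Submodule ℝ F := LinearMap.range (sumBracket ψ w).toLinearMap
  have h1 : ∀ a b, transportedBracket ψ a b ∈ R := by
    intro a b
    have hb : b ∈ Submodule.span ℝ (Set.range w) := hw ▸ Submodule.mem_top
    induction hb using Submodule.span_induction with
    | mem b hb =>
      obtain ⟨i, rfl⟩ := hb
      refine ⟨Pi.single i a, ?_⟩
      change sumBracket ψ w (Pi.single i a) = _
      rw [sumBracket_apply, Finset.sum_eq_single i, Pi.single_eq_same, transportedBracket_apply]
      · intro j _ hj
        rw [Pi.single_eq_of_ne hj]
        simp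
      · simp
    | zero => rw [map_zero]; exact R.zero_mem
    | add b c _ _ hb hc => rw [map_add]; exact R.add_mem hb hc
    | smul c b _ hb => rw [map_smul]; exact R.smul_mem c hb
  -- `R` is only a real subspace while the derived ideal is a `𝕜`-span. Quantifying over `c` lets
  -- scalars of `𝕜` be absorbed into the first entry of a bracket, which is arbitrary.
  have h2 : ∀ z ∈ Submodule.span 𝕜 {m : 𝔨 | ∃ (x : (⊤ : LieIdeal 𝕜 𝔨)) (n : (⊤ : LieIdeal 𝕜 𝔨)),
      ⁅(x : 𝔨), (n : 𝔨)⁆ = m}, ∀ c : 𝕜, ψ.symm (c • z) ∈ R := by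
    intro z hz
    induction hz using Submodule.span_induction with
    | mem z hz =>
      obtain ⟨a, b, rfl⟩ := hz
      intro c
      have := h1 (ψ.symm (c • (a : 𝔨))) (ψ.symm (b : 𝔨))
      rwa [transportedBracket_apply, ψ.apply_symm_apply, ψ.apply_symm_apply, smul_lie] at this
    | zero => intro c; rw [smul_zero, map_zero]; exact R.zero_mem
    | add y z _ _ hy hz => intro c; rw [smul_add, map_add]; exact R.add_mem (hy c) (hz c)
    | smul d z _ hz => intro c; rw [smul_smul]; exact hz _
  intro z
  have hz : ψ z ∈ ⁅(⊤ : LieIdeal 𝕜 𝔨), (⊤ : LieIdeal 𝕜 𝔨)⁆ := by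
    rw [h]
    exact LieSubmodule.mem_top _
  rw [← LieSubmodule.mem_toSubmodule, LieSubmodule.lieIdeal_oper_eq_linear_span] at hz
  have := h2 _ hz 1
  rwa [one_smul, ψ.symm_apply_apply] at this

end TransportedBracket

/-! ### Gluing local solutions of convex problems -/

section Gluing

/-- Finitely many sections that locally solve a convex problem can be glued to global ones. -/
theorem exists_sections_forall_mem_convex_of_local
    {E : Type*} [NormedAddCommGroup E] [NormedSpace ℝ E] [FiniteDimensional ℝ E]
    {M : Type*} [TopologicalSpace M] [ChartedSpace E M] [IsManifold 𝓘(ℝ, E) ∞ M] [T2Space M]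
    [SigmaCompactSpace M]
    {F : Type*} [NormedAddCommGroup F] [NormedSpace ℝ F]
    {V : M → Type*} [∀ x, AddCommGroup (V x)] [∀ x, Module ℝ (V x)]
    [TopologicalSpace (TotalSpace F V)] [∀ x, TopologicalSpace (V x)]
    [FiberBundle F V] [VectorBundle ℝ F V] {k : ℕ∞} {ι : Type*}
    {t : ∀ x, Set (ι → V x)} (ht : ∀ x, Convex ℝ (t x))
    (hloc : ∀ x₀ : M, ∃ U ∈ nhds x₀, ∃ s : ι → ∀ x, V x,
      (∀ i, ∀ x ∈ U, ContMDiffAt 𝓘(ℝ, E) (𝓘(ℝ, E).prod 𝓘(ℝ, F)) k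
        (fun x => (⟨x, s i x⟩ : TotalSpace F V)) x) ∧ ∀ x ∈ U, (fun i => s i x) ∈ t x) :
    ∃ s : ι → ∀ x, V x, (∀ i, IsCSection 𝓘(ℝ, E) F k (s i)) ∧ ∀ x, (fun i => s i x) ∈ t x := by
  choose W hW s hs hst using hloc
  obtain ⟨ρ, hρ⟩ := SmoothPartitionOfUnity.exists_isSubordinate 𝓘(ℝ, E) isClosed_univ
    (fun x => interior (W x)) (fun _ => isOpen_interior)
    (fun x _ => Set.mem_iUnion.2 ⟨x, mem_interior_iff_mem_nhds.2 (hW x)⟩)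
  refine ⟨fun i x => ∑ᶠ j, ρ j x • s j i x, fun i => ?_, fun x => ?_⟩
  · refine ContMDiff.finsum_section_of_locallyFinite
      (ρ.locallyFinite.subset fun j x hx => left_ne_zero_of_smul hx) fun j => ?_
    refine ContMDiffOn.smul_section_of_tsupport
      (((ρ j).contMDiff.of_le (by exact_mod_cast le_top)).contMDiffOn) isOpen_interior (hρ j) ?_
    exact fun x hx => (hs j i x (interior_subset hx)).contMDiffWithinAt
  · have hfin : (Function.support fun j => ρ j x • fun i => s j i x).Finite :=
      (ρ.locallyFinite.point_finite x).subset fun j hj => left_ne_zero_of_smul hj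
    have heq : (fun i => ∑ᶠ j, ρ j x • s j i x) = ∑ᶠ j, ρ j x • fun i => s j i x := by
      funext i
      exact ((Pi.evalAddMonoidHom (fun _ : ι => V x) i).map_finsum hfin).symm
    rw [heq]
    refine (ht x).finsum_mem (ρ.nonneg · x) (ρ.sum_eq_one (Set.mem_univ x)) fun j hj => ?_
    exact hst j x (interior_subset (hρ j (subset_tsupport _ hj)))

end Gluing

/-! ### Sections as sums of brackets -/

section Perfect

variable {𝕜 : Type*} [RCLike 𝕜]
  {E : Type*} [NormedAddCommGroup E] [NormedSpace ℝ E] [FiniteDimensional ℝ E]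
  {M : Type*} [TopologicalSpace M] [ChartedSpace E M] [IsManifold 𝓘(ℝ, E) ∞ M] [T2Space M]
  [SigmaCompactSpace M]
  {𝔨 : Type*} [LieRing 𝔨] [LieAlgebra 𝕜 𝔨]
  {F : Type*} [NormedAddCommGroup F] [NormedSpace ℝ F] [NormedSpace 𝕜 F] [IsScalarTower ℝ 𝕜 F]
  [FiniteDimensional ℝ F]
  {L : M → Type*} [∀ x, LieRing (L x)] [∀ x, LieAlgebra 𝕜 (L x)]
  [∀ x, Module ℝ (L x)] [∀ x, IsScalarTower ℝ 𝕜 (L x)]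
  [TopologicalSpace (TotalSpace F L)] [∀ x, TopologicalSpace (L x)]
  [FiberBundle F L] [VectorBundle ℝ F L]

/-- If the fibers are perfect and spanned by the sections `w i`, then every section `X` is of the
form `∑ i, ⁅u i, w i⁆` with sections `u i` that vanish wherever `X` does. -/
theorem IsLieAlgebraBundle.exists_eq_sum_lie (hL : IsLieAlgebraBundle 𝕜 𝓘(ℝ, E) 𝔨 F L)
    (hperf : ⁅(⊤ : LieIdeal 𝕜 𝔨), (⊤ : LieIdeal 𝕜 𝔨)⁆ = ⊤)
    {ι : Type*} [Fintype ι] {w : ι → ∀ x, L x} (hw : ∀ i, IsCSection 𝓘(ℝ, E) F ⊤ (w i))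
    (hspan : ∀ x, SpansAt w x) {k : ℕ∞} {X : ∀ x, L x} (hX : IsCSection 𝓘(ℝ, E) F k X) :
    ∃ u : ι → ∀ x, L x, (∀ i, IsCSection 𝓘(ℝ, E) F k (u i)) ∧
      ∀ x, ∑ i, ⁅u i x, w i x⁆ = X x ∧ (X x = 0 → ∀ i, u i x = 0) := by
  -- An affine equation together with a linear vanishing condition is convex in each fiber, so both
  -- survive a partition of unity.
  refine exists_sections_forall_mem_convex_of_local
    (t := fun x => {u | ∑ i, ⁅u i, w i x⁆ = X x ∧ (X x = 0 → ∀ i, u i = 0)}) (fun x => ?_)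
    fun x₀ => ?_
  · rintro u ⟨hu, hu0⟩ v ⟨hv, hv0⟩ a b - - hab
    refine ⟨?_, fun hx i => ?_⟩
    · have hsmul : ∀ (c : ℝ) (y z : L x), ⁅c • y, z⁆ = c • ⁅y, z⁆ := fun c y z => by
        rw [← algebraMap_smul 𝕜 c y, smul_lie, algebraMap_smul]
      simp only [Pi.add_apply, Pi.smul_apply, add_lie, hsmul, Finset.sum_add_distrib,
        ← Finset.smul_sum, hu, hv, ← add_smul, hab, one_smul]
    · simp [hu0 hx i, hv0 hx i]
  · obtain ⟨e, ψ, hx₀, h⟩ := hL.exists_isLieChart x₀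
    let wF : M → ι → F := fun x i => (e ⟨x, w i x⟩).2
    have hwF : ∀ x ∈ e.baseSet, ContMDiffAt 𝓘(ℝ, E) 𝓘(ℝ, ι → F) k wF x := fun x hx =>
      contMDiffAt_pi_space.2 fun i => (h.contMDiffAt_iff hx).1 ((hw i).of_top x)
    have hsurj : Function.Surjective (sumBracket ψ (wF x₀)) := by
      refine surjective_sumBracket hperf ψ ?_
      by_contra hne
      obtain ⟨f, hf, hker⟩ := Submodule.exists_le_ker_of_lt_top _ (lt_top_iff_ne_top.2 hne)
      obtain ⟨ε, hε, -⟩ := h.exists_linearEquiv hx₀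
      have h0 := hspan x₀ (f ∘ₗ ε.toLinearMap) fun i => by
        have := hker (Submodule.subset_span ⟨i, rfl⟩)
        rw [LinearMap.mem_ker] at this
        change f (e ⟨x₀, w i x₀⟩).2 = 0 at this
        rwa [hε] at this
      refine hf (LinearMap.ext fun z => ?_)
      simpa using! LinearMap.congr_fun h0 (ε.symm z)
    obtain ⟨R, hR⟩ := exists_contDiffAt_rightInverse hsurj k
    -- The local solution is linear in the value of `X`, hence vanishes where `X` does.
    let g : M → ι → F := fun x => R (sumBracket ψ (wF x)) (e ⟨x, X x⟩).2
    have hcont : ContinuousAt (fun x => sumBracket ψ (wF x)) x₀ :=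
      (contDiff_sumBracket (ι := ι) ψ 0).continuous.continuousAt.comp (hwF x₀ hx₀).continuousAt
    refine ⟨_, Filter.inter_mem (hcont.eventually hR) (e.open_baseSet.mem_nhds hx₀),
      fun i x => e.symm x (g x i), ?_, ?_⟩
    · rintro i x ⟨hx, hxe⟩
      have h1 : ContMDiffAt 𝓘(ℝ, E) 𝓘(ℝ, F →L[ℝ] (ι → F)) k
          (fun x => R (sumBracket ψ (wF x))) x :=
        ContMDiffAt.comp (g := R) (f := fun x => sumBracket ψ (wF x)) x hx.1.contMDiffAt
          (ContMDiffAt.comp (g := (sumBracket ψ : (ι → F) → _)) x (contDiff_sumBracket (ι := ι) ψ k).contDiffAt.contMDiffAt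
            (hwF x hxe))
      have h2 : ContMDiffAt 𝓘(ℝ, E) 𝓘(ℝ, ι → F) k g x :=
        h1.clm_apply ((h.contMDiffAt_iff hxe).1 (hX x))
      exact h.contMDiffAt_symm hxe (contMDiffAt_pi_space.1 h2 i)
    · rintro x ⟨hx, hxe⟩
      obtain ⟨ε, hε, hbr⟩ := h.exists_linearEquiv hxe
      have hs : ∀ i, ε (e.symm x (g x i)) = g x i := fun i => by
        rw [← hε, e.apply_mk_symm hxe]
      refine ⟨ε.injective ?_, fun hx0 i => ε.injective ?_⟩
      · have h3 : ∑ i, ψ.symm ⁅ψ (g x i), ψ (wF x i)⁆ = (e ⟨x, X x⟩).2 := by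
          rw [← sumBracket_apply]
          exact hx.2 _
        rw [map_sum, ← hε (X x), ← h3]
        refine Finset.sum_congr rfl fun i _ => ?_
        rw [hbr, hs, ← hε (w i x)]
      · have h4 : g x = 0 := by
          change R (sumBracket ψ (wF x)) (e ⟨x, X x⟩).2 = 0
          rw [hε, hx0, map_zero, map_zero]
        rw [hs, h4, map_zero, Pi.zero_apply]

end Perfect
-- The algebraic dichotomy and complementary ideals
section Algebra

variable {𝕜 𝔤 : Type*} [Field 𝕜] [LieRing 𝔤] [LieAlgebra 𝕜 𝔤]

/-- If there is no nonzero morphism from the abelianization to the center, then the center vanishes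
or the Lie algebra is perfect. -/
theorem center_eq_bot_or_perfect
    (h : ∀ f : (𝔤 ⧸ ⁅(⊤ : LieIdeal 𝕜 𝔤), (⊤ : LieIdeal 𝕜 𝔤)⁆) →ₗ⁅𝕜⁆ LieAlgebra.center 𝕜 𝔤, f = 0) :
    LieAlgebra.center 𝕜 𝔤 = ⊥ ∨ ⁅(⊤ : LieIdeal 𝕜 𝔤), (⊤ : LieIdeal 𝕜 𝔤)⁆ = ⊤ := by
  by_contra! hne
  obtain ⟨c, hc, hc0⟩ : ∃ c ∈ LieAlgebra.center 𝕜 𝔤, c ≠ 0 := by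
    by_contra! hall
    exact hne.1 ((LieSubmodule.eq_bot_iff _).2 hall)
  obtain ⟨z, hz⟩ : ∃ z : 𝔤, z ∉ ⁅(⊤ : LieIdeal 𝕜 𝔤), (⊤ : LieIdeal 𝕜 𝔤)⁆ := by
    by_contra! hall
    exact hne.2 (eq_top_iff.2 fun z _ => hall z)
  have hz0 : (LieSubmodule.Quotient.mk z : 𝔤 ⧸ ⁅(⊤ : LieIdeal 𝕜 𝔤), (⊤ : LieIdeal 𝕜 𝔤)⁆) ≠ 0 :=
    fun h0 => hz ((LieSubmodule.Quotient.mk_eq_zero _).1 h0)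
  obtain ⟨f, hf⟩ : ∃ f : Module.Dual 𝕜 (𝔤 ⧸ ⁅(⊤ : LieIdeal 𝕜 𝔤), (⊤ : LieIdeal 𝕜 𝔤)⁆),
      f (LieSubmodule.Quotient.mk z) ≠ 0 := by
    by_contra! h0
    exact hz0 ((Module.forall_dual_apply_eq_zero_iff 𝕜 _).1 h0)
  have habel : ∀ a b : 𝔤 ⧸ ⁅(⊤ : LieIdeal 𝕜 𝔤), (⊤ : LieIdeal 𝕜 𝔤)⁆, ⁅a, b⁆ = 0 := by
    intro a b
    obtain ⟨a, rfl⟩ := LieSubmodule.Quotient.surjective_mk' _ a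
    obtain ⟨b, rfl⟩ := LieSubmodule.Quotient.surjective_mk' _ b
    exact (LieSubmodule.Quotient.mk_eq_zero _).2
      (LieSubmodule.lie_mem_lie (LieSubmodule.mem_top a) (LieSubmodule.mem_top b))
  -- This rank-one map preserves brackets because source and target are both abelian.
  let g : (𝔤 ⧸ ⁅(⊤ : LieIdeal 𝕜 𝔤), (⊤ : LieIdeal 𝕜 𝔤)⁆) →ₗ⁅𝕜⁆ LieAlgebra.center 𝕜 𝔤 :=
    { f.smulRight (⟨c, hc⟩ : LieAlgebra.center 𝕜 𝔤) with
      map_lie' := fun {a b} => by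
        have h0 := (LinearMap.congr_arg (f := f.smulRight (⟨c, hc⟩ : LieAlgebra.center 𝕜 𝔤))
          (habel a b)).trans (map_zero _)
        exact h0.trans (trivial_lie_zero _ _ _ _).symm }
  have hg : g (LieSubmodule.Quotient.mk z) = 0 := by rw [h g]; rfl
  have hg' : f (LieSubmodule.Quotient.mk z) • c = 0 := congrArg Subtype.val hg
  exact (smul_ne_zero hf hc0) hg'

/-- Complementary ideals commute. -/
theorem lie_eq_zero_of_disjoint {A B : LieIdeal 𝕜 𝔤} (h : Disjoint A B) {a b : 𝔤} (ha : a ∈ A)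
    (hb : b ∈ B) : ⁅a, b⁆ = 0 := by
  have h1 : ⁅a, b⁆ ∈ A := by
    rw [← lie_skew]
    exact A.neg_mem (A.lie_mem ha)
  have h2 : ⁅a, b⁆ ∈ A ⊓ B := ⟨h1, B.lie_mem hb⟩
  rwa [h.eq_bot] at h2

theorem exists_add_eq {A B : LieIdeal 𝕜 𝔤} (h : IsCompl A B) (X : 𝔤) :
    ∃ a ∈ A, ∃ b ∈ B, a + b = X := by
  have : X ∈ A ⊔ B := h.sup_eq_top ▸ LieSubmodule.mem_top X
  exact (LieSubmodule.mem_sup _ _ _).1 this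

end Algebra

/-! ### Direct sum decompositions of the section algebra -/

section Decomposition

variable {𝕜 : Type*} [RCLike 𝕜]
  {E : Type*} [NormedAddCommGroup E] [NormedSpace ℝ E]
  {M : Type*} [TopologicalSpace M] [ChartedSpace E M]
  {𝔨 : Type*} [LieRing 𝔨] [LieAlgebra 𝕜 𝔨] [FiniteDimensional 𝕜 𝔨]
  {F : Type*} [NormedAddCommGroup F] [NormedSpace ℝ F] [NormedSpace 𝕜 F] [IsScalarTower ℝ 𝕜 F]
  {L : M → Type*} [∀ x, LieRing (L x)] [∀ x, LieAlgebra 𝕜 (L x)]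
  [∀ x, Module ℝ (L x)] [∀ x, IsScalarTower ℝ 𝕜 (L x)]
  [TopologicalSpace (TotalSpace F L)] [∀ x, TopologicalSpace (L x)] [FiberBundle F L]
  {hL : IsLieAlgebraBundle 𝕜 𝓘(ℝ, E) 𝔨 F L} {k : ℕ∞}
  {A B : LieIdeal 𝕜 (sectionLieAlgebra hL k)}

theorem isOpen_exists_apply_ne_zero (A : LieIdeal 𝕜 (sectionLieAlgebra hL k)) :
    IsOpen {x | ∃ a ∈ A, a.1 x ≠ 0} := by
  have : {x | ∃ a ∈ A, a.1 x ≠ 0} = ⋃ a ∈ A, {x | a.1 x ≠ 0} := by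
    ext x
    simp
  rw [this]
  exact isOpen_biUnion fun a _ => IsCSection.isOpen_ne_zero hL a.2

variable [FiniteDimensional ℝ E] [IsManifold 𝓘(ℝ, E) ∞ M] [T2Space M] [VectorBundle ℝ F L]

theorem sectionLieAlgebra_exists_eq (hL : IsLieAlgebraBundle 𝕜 𝓘(ℝ, E) 𝔨 F L) (k : ℕ∞) {x : M}
    (v : L x) : ∃ X : sectionLieAlgebra hL k, X.1 x = v :=
  let ⟨X, hX, hXv⟩ := hL.exists_section_eq x v
  ⟨⟨X, hX.of_top⟩, hXv⟩

/-- The ideal of values at a point of an ideal of sections, transported to `𝔨`. -/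
def valueIdeal {x : M} (φ : L x ≃ₗ⁅𝕜⁆ 𝔨) (A : LieIdeal 𝕜 (sectionLieAlgebra hL k)) :
    LieIdeal 𝕜 𝔨 where
  carrier := {z | ∃ a ∈ A, φ (a.1 x) = z}
  zero_mem' := ⟨0, A.zero_mem, map_zero φ⟩
  add_mem' := by
    rintro _ _ ⟨a, ha, rfl⟩ ⟨b, hb, rfl⟩
    exact ⟨a + b, A.add_mem ha hb, map_add φ _ _⟩
  smul_mem' := by
    rintro c _ ⟨a, ha, rfl⟩
    exact ⟨c • a, A.smul_mem c ha, map_smul φ _ _⟩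
  lie_mem := by
    rintro y _ ⟨a, ha, rfl⟩
    -- The values are stable under bracketing with all of `𝔨` because `y` lifts to a global section.
    obtain ⟨Y, hY⟩ := sectionLieAlgebra_exists_eq hL k (φ.symm y)
    refine ⟨⁅Y, a⁆, A.lie_mem ha, ?_⟩
    change φ ⁅Y.1 x, a.1 x⁆ = _
    rw [hY, LieEquiv.map_lie, LieEquiv.apply_symm_apply]

/-- If the values of complementary ideals of sections meet trivially in each fiber, then at each
point one of the two ideals vanishes. -/
theorem forall_apply_eq_zero_or (h𝔨 : IsIndecomposable 𝕜 𝔨) (h : IsCompl A B)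
    (hdisj : ∀ a ∈ A, ∀ b ∈ B, ∀ x, a.1 x = b.1 x → a.1 x = 0) (x : M) :
    (∀ a ∈ A, a.1 x = 0) ∨ ∀ b ∈ B, b.1 x = 0 := by
  obtain ⟨e, ψ, hx, he⟩ := hL.exists_isLieChart x
  obtain ⟨φ, -⟩ := he.fiber x hx
  have hcompl : IsCompl (valueIdeal φ A) (valueIdeal φ B) := by
    constructor
    · rw [disjoint_iff, LieSubmodule.eq_bot_iff]
      rintro z ⟨⟨a, ha, hz⟩, ⟨b, hb, rfl⟩⟩
      rw [← hz, hdisj a ha b hb x (φ.injective hz), map_zero]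
    · rw [codisjoint_iff, eq_top_iff]
      intro z _
      obtain ⟨X, hX⟩ := sectionLieAlgebra_exists_eq hL k (φ.symm z)
      obtain ⟨a, ha, b, hb, rfl⟩ := exists_add_eq h X
      refine (LieSubmodule.mem_sup _ _ _).2 ⟨_, ⟨a, ha, rfl⟩, _, ⟨b, hb, rfl⟩, ?_⟩
      rw [← map_add]
      change φ ((a + b).1 x) = z
      rw [hX, LieEquiv.apply_symm_apply]
  have hzero : ∀ C : LieIdeal 𝕜 (sectionLieAlgebra hL k), valueIdeal φ C = ⊥ →
      ∀ c ∈ C, c.1 x = 0 := by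
    intro C hC c hc
    have : φ (c.1 x) ∈ valueIdeal φ C := ⟨c, hc, rfl⟩
    rw [hC, LieSubmodule.mem_bot] at this
    exact φ.injective (this.trans (map_zero φ).symm)
  by_contra! hne
  obtain ⟨⟨a, ha, hax⟩, ⟨b, hb, hbx⟩⟩ := hne
  refine h𝔨 ⟨_, _, fun hA => hbx (hzero B ?_ b hb), fun hB => hax (hzero A ?_ a ha), hcompl⟩
  · simpa [hA] using hcompl.inf_eq_bot
  · simpa [hB] using hcompl.inf_eq_bot

/-- Over a connected manifold, complementary ideals of sections whose values meet trivially in each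
fiber are trivial. -/
theorem eq_top_or_eq_top_of_isCompl [ConnectedSpace M] (h𝔨 : IsIndecomposable 𝕜 𝔨)
    (h : IsCompl A B) (hdisj : ∀ a ∈ A, ∀ b ∈ B, ∀ x, a.1 x = b.1 x → a.1 x = 0) :
    A = ⊤ ∨ B = ⊤ := by
  have hor := forall_apply_eq_zero_or h𝔨 h hdisj
  have hbot : ∀ C : LieIdeal 𝕜 (sectionLieAlgebra hL k), (∀ x, ∀ c ∈ C, c.1 x = 0) → C = ⊥ :=
    fun C hC => (LieSubmodule.eq_bot_iff _).2 fun c hc => Subtype.ext (funext fun x => hC x c hc)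
  have htop : (∀ x, ∀ a ∈ A, a.1 x = 0) → B = ⊤ := fun hA => by
    simpa [hbot A hA] using h.sup_eq_top
  -- If both ideals vanish at one point, that fiber is zero, hence so are `𝔨` and all sections. This
  -- degenerate case is allowed: the zero algebra has no proper ideal and counts as indecomposable.
  by_cases hx : ∃ x, (∀ a ∈ A, a.1 x = 0) ∧ ∀ b ∈ B, b.1 x = 0
  · obtain ⟨x, hxA, hxB⟩ := hx
    have hfib : ∀ y, ∃ φ : L y ≃ₗ⁅𝕜⁆ 𝔨, True := fun y => by
      obtain ⟨e, ψ, hy, he⟩ := hL.exists_isLieChart y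
      obtain ⟨φ, -⟩ := he.fiber y hy
      exact ⟨φ, trivial⟩
    have hLx : ∀ v : L x, v = 0 := fun v => by
      obtain ⟨X, rfl⟩ := sectionLieAlgebra_exists_eq hL k v
      obtain ⟨a, ha, b, hb, rfl⟩ := exists_add_eq h X
      change a.1 x + b.1 x = 0
      rw [hxA a ha, hxB b hb, add_zero]
    refine Or.inr (htop fun y a _ => ?_)
    obtain ⟨φ, -⟩ := hfib x
    obtain ⟨χ, -⟩ := hfib y
    have := hLx (φ.symm (χ (a.1 y)))
    simpa using this
  · push Not at hx
    have hcompl : {x | ∃ a ∈ A, a.1 x ≠ 0} = {x | ∃ b ∈ B, b.1 x ≠ 0}ᶜ := by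
      ext x
      simp only [Set.mem_ofPred_eq, Set.mem_compl_iff, not_exists, not_and, not_not]
      refine ⟨fun ⟨a, ha, hax⟩ => (hor x).resolve_left fun h0 => hax (h0 a ha), fun hB => ?_⟩
      by_contra! hA
      obtain ⟨b, hb, hbx⟩ := hx x hA
      exact hbx (hB b hb)
    have hclopen : IsClopen {x | ∃ a ∈ A, a.1 x ≠ 0} := by
      refine ⟨?_, isOpen_exists_apply_ne_zero A⟩
      rw [hcompl]
      exact (isOpen_exists_apply_ne_zero B).isClosed_compl
    rcases isClopen_iff.1 hclopen with hU | hU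
    · refine Or.inr (htop fun x a ha => ?_)
      by_contra hax
      exact (hU ▸ (⟨a, ha, hax⟩ : x ∈ {x | ∃ a ∈ A, a.1 x ≠ 0}) : x ∈ (∅ : Set M))
    · refine Or.inl ?_
      have hB : B = ⊥ := hbot B fun x b hb => by
        have hx : x ∈ {x | ∃ a ∈ A, a.1 x ≠ 0} := hU ▸ Set.mem_univ x
        rw [hcompl] at hx
        by_contra hbx
        exact hx ⟨b, hb, hbx⟩
      simpa [hB] using h.sup_eq_top

/-- As a value of `A`, the common value commutes with the values of `B`; as a value of `B`, with
those of `A`. Together these fill the fiber. -/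
theorem apply_eq_zero_of_center_eq_bot (h𝔨 : LieAlgebra.center 𝕜 𝔨 = ⊥) (h : IsCompl A B)
    {a b : sectionLieAlgebra hL k} (ha : a ∈ A) (hb : b ∈ B) {x : M} (hab : a.1 x = b.1 x) :
    a.1 x = 0 := by
  obtain ⟨e, ψ, hx, he⟩ := hL.exists_isLieChart x
  obtain ⟨φ, -⟩ := he.fiber x hx
  have hcomm : ∀ v : L x, ⁅v, a.1 x⁆ = 0 := fun v => by
    obtain ⟨X, rfl⟩ := sectionLieAlgebra_exists_eq hL k v
    obtain ⟨p, hp, q, hq, rfl⟩ := exists_add_eq h X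
    have h1 : ⁅p.1 x, b.1 x⁆ = 0 :=
      congrFun (congrArg Subtype.val (lie_eq_zero_of_disjoint h.disjoint hp hb)) x
    have h2 : ⁅q.1 x, a.1 x⁆ = 0 :=
      congrFun (congrArg Subtype.val (lie_eq_zero_of_disjoint h.disjoint.symm hq ha)) x
    change ⁅p.1 x + q.1 x, a.1 x⁆ = 0
    rw [add_lie, h2, hab, h1, add_zero]
  have hmem : φ (a.1 x) ∈ LieAlgebra.center 𝕜 𝔨 := by
    refine (LieModule.mem_maxTrivSubmodule 𝕜 𝔨 𝔨 _).2 fun z => ?_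
    have := congrArg φ (hcomm (φ.symm z))
    rwa [LieEquiv.map_lie, LieEquiv.apply_symm_apply, map_zero] at this
  rw [h𝔨, LieSubmodule.mem_bot] at hmem
  exact φ.injective (hmem.trans (map_zero φ).symm)

/-- The difference `a - b` vanishes at `x`, so it is a sum of brackets with first entries vanishing
at `x`; the part of this sum lying in `A` is `a`. -/
theorem apply_eq_zero_of_perfect [SigmaCompactSpace M]
    (hperf : ⁅(⊤ : LieIdeal 𝕜 𝔨), (⊤ : LieIdeal 𝕜 𝔨)⁆ = ⊤) (h : IsCompl A B)
    {a b : sectionLieAlgebra hL k} (ha : a ∈ A) (hb : b ∈ B) {x : M} (hab : a.1 x = b.1 x) :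
    a.1 x = 0 := by
  obtain ⟨e, ψ, hx, he⟩ := hL.exists_isLieChart x
  have : FiniteDimensional 𝕜 F := ψ.symm.finiteDimensional
  have : FiniteDimensional ℝ F := FiniteDimensional.trans ℝ 𝕜 F
  obtain ⟨w, hw, hspan⟩ := hL.exists_spansAt
  obtain ⟨u, hu, hsum⟩ := hL.exists_eq_sum_lie hperf hw hspan (a - b).2
  have hu0 : ∀ i, u i x = 0 := (hsum x).2 (sub_eq_zero.2 hab)
  let U : _ → sectionLieAlgebra hL k := fun i => ⟨u i, hu i⟩
  choose p hp q hq hpq using fun i =>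
    exists_add_eq h (⟨w i, (hw i).of_top⟩ : sectionLieAlgebra hL k)
  have hval : ∀ r : _ → sectionLieAlgebra hL k, (∑ i, ⁅U i, r i⁆).1 x = 0 := by
    intro r
    have : (∑ i, ⁅U i, r i⁆).1 = ∑ i, (⁅U i, r i⁆).1 := map_sum (sectionLieAlgebra hL k).subtype _ _
    rw [this, Finset.sum_apply]
    refine Finset.sum_eq_zero fun i _ => ?_
    change ⁅u i x, (r i).1 x⁆ = 0
    rw [hu0, zero_lie]
  have heq : a - b = ∑ i, ⁅U i, p i⁆ + ∑ i, ⁅U i, q i⁆ := by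
    rw [← Finset.sum_add_distrib]
    simp only [← lie_add, hpq]
    refine Subtype.ext (funext fun y => ?_)
    have : (∑ i, ⁅U i, (⟨w i, (hw i).of_top⟩ : sectionLieAlgebra hL k)⁆).1 =
      ∑ i, (⁅U i, (⟨w i, (hw i).of_top⟩ : sectionLieAlgebra hL k)⁆).1 :=
      map_sum (sectionLieAlgebra hL k).subtype _ _
    rw [this, Finset.sum_apply]
    exact (hsum y).1.symm
  have hA : a - ∑ i, ⁅U i, p i⁆ ∈ A := A.sub_mem ha (sum_mem fun i _ => A.lie_mem (hp i))
  have hB : a - ∑ i, ⁅U i, p i⁆ ∈ B := by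
    have : a - ∑ i, ⁅U i, p i⁆ = b + ∑ i, ⁅U i, q i⁆ := by
      rw [sub_eq_iff_eq_add, add_assoc, add_comm (∑ i, ⁅U i, q i⁆), ← heq, add_sub_cancel]
    rw [this]
    exact B.add_mem hb (sum_mem fun i _ => B.lie_mem (hq i))
  have h0 : a - ∑ i, ⁅U i, p i⁆ ∈ A ⊓ B := ⟨hA, hB⟩
  rw [h.inf_eq_bot, LieSubmodule.mem_bot, sub_eq_zero] at h0
  rw [h0]
  exact hval p

end Decomposition

end LieBundle

theorem mainTheorem8
    {𝕜 : Type*} [RCLike 𝕜]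
    {E : Type*} [NormedAddCommGroup E] [NormedSpace ℝ E] [FiniteDimensional ℝ E]
    {M : Type*} [TopologicalSpace M] [ChartedSpace E M] [IsManifold 𝓘(ℝ, E) ∞ M]
    [T2Space M] [ParacompactSpace M] [ConnectedSpace M]
    {𝔨 : Type*} [LieRing 𝔨] [LieAlgebra 𝕜 𝔨] [FiniteDimensional 𝕜 𝔨]
    {F : Type*} [NormedAddCommGroup F] [NormedSpace ℝ F] [NormedSpace 𝕜 F] [IsScalarTower ℝ 𝕜 F]
    {L : M → Type*} [∀ x, LieRing (L x)] [∀ x, LieAlgebra 𝕜 (L x)]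
    [∀ x, Module ℝ (L x)] [∀ x, IsScalarTower ℝ 𝕜 (L x)]
    [TopologicalSpace (TotalSpace F L)] [∀ x, TopologicalSpace (L x)]
    [FiberBundle F L] [VectorBundle ℝ F L] [ContMDiffVectorBundle ∞ F L 𝓘(ℝ, E)]
    (hL : LieBundle.IsLieAlgebraBundle 𝕜 𝓘(ℝ, E) 𝔨 F L) (k : ℕ∞)
    (h𝔨 : LieBundle.IsIndecomposable 𝕜 𝔨)
    (hHom : ∀ f : (𝔨 ⧸ ⁅(⊤ : LieIdeal 𝕜 𝔨), (⊤ : LieIdeal 𝕜 𝔨)⁆) →ₗ⁅𝕜⁆ LieAlgebra.center 𝕜 𝔨,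
      f = 0) :
    LieBundle.IsIndecomposable 𝕜 (LieBundle.sectionLieAlgebra hL k) := by
  have : LocallyCompactSpace M := Manifold.locallyCompact_of_finiteDimensional 𝓘(ℝ, E)
  have : SigmaCompactSpace M := LieBundle.sigmaCompactSpace_of_connected_of_paracompact M
  rintro ⟨A, B, hA, hB, h⟩
  have hdisj : ∀ a ∈ A, ∀ b ∈ B, ∀ x, a.1 x = b.1 x → a.1 x = 0 := by
    intro a ha b hb x hab
    rcases LieBundle.center_eq_bot_or_perfect hHom with hc | hp
    · exact LieBundle.apply_eq_zero_of_center_eq_bot hc h ha hb hab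
    · exact LieBundle.apply_eq_zero_of_perfect hp h ha hb hab
  exact (LieBundle.eq_top_or_eq_top_of_isCompl h𝔨 h hdisj).elim hA hB
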